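/- Boolean formulae over atoms $\{1,\dots,n\}$ are built from the atoms with operators $o$ of any arity $p$, each interpreted by a function $\mathbb B^p\to\mathbb B$. An interpretation is a function $i:\{1,\dots,n\}\to\mathbb B$, and it satisfies $\phi$ if $\mathrm{eval}_i(\phi)=1$. Extended expressions over an alphabet $\Sigma$ are built from the symbols $a\in\Sigma$, $\emptyset$, $\varepsilon$ by $F+G$, $F\cdot G$, $F^*$ and constrained tildes $\phi(E_1,\dots,E_n)$, with $n\ge 0$ and $\phi$ a Boolean formula over $\{1,\dots,n\}$. The language $L(E)$ is defined as usual on the regular operators, and $$L(\phi(E_1,\dots,E_n))=\bigcup_{i\,:\,\mathrm{eval}_i(\phi)=1}L'_{i,1}\cdots L'_{i,n},\qquad L'_{i,k}=\{\varepsilon\}\text{ if } i(k)=1,\quad L'_{i,k}=L(E_k)\text{ otherwise.}$$ *Linearization.* A linearization $E^\sharp$ of $E$ is obtained by indexing every occurrence of a symbol with a couple $(k,[\,])$, the integers $k$ of distinct occurrences being distinct (for instance, numbering the occurrences from left to right starting at $1$). The delinearization $\mathrm h$ sends each indexed symbol $a_{k,[c_1,\dots,c_l]}$ to $a$. *Development.*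 For each formula $\phi$ fix a numbering $i_1,\dots,i_k$, without repetition, of all interpretations satisfying $\phi$. Put $$\mathrm{dev}_\phi(E_1,\dots,E_n)=\sum_{j=1}^{k}\ \prod_{1\le m\le n,\ i_j(m)=0}\mathrm{ind}_j(E_m),$$ with the product taken in increasing order of $m$, the empty sum being $\emptyset$ and the empty product $\varepsilon$, where $\mathrm{ind}_j$ replaces each $a_{k,[c_1,\dots,c_l]}$ by $a_{k,[j,c_1,\dots,c_l]}$. *Position functions.* For expressions over indexed symbols, $\mathrm{Null}(E)$ means $\varepsilon\in L(E)$. The sets $\mathrm{Pos},\mathrm{First},\mathrm{Last},\mathrm{Follow}$ are computed recursively. On a symbol $x$ the first three are $\{x\}$ and $\mathrm{Follow}(x)=\emptyset$; on $\emptyset$ and $\varepsilon$ all are empty; all four turn $+$ into $\cup$. Further, - $\mathrm{Pos}(F\cdot G)=\mathrm{Pos}(F)\cup\mathrm{Pos}(G)$; - $\mathrm{First}(F\cdot G)=\mathrm{First}(F)$, together with $\mathrm{First}(G)$ if $\mathrm{Null}(F)$; - $\mathrm{Last}(F\cdot G)=\mathrm{Last}(G)$, together with $\mathrm{Last}(F)$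 if $\mathrm{Null}(G)$; - $\mathrm{Follow}(F\cdot G)=\mathrm{Follow}(F)\cup\mathrm{Follow}(G)\cup\mathrm{Last}(F)\times\mathrm{First}(G)$; - $\mathrm{Pos}$, $\mathrm{First}$, $\mathrm{Last}$ of $F^*$ are those of $F$, and $\mathrm{Follow}(F^*)=\mathrm{Follow}(F)\cup\mathrm{Last}(F)\times\mathrm{First}(F)$; - each of the four sets of $\phi(E_1,\dots,E_n)$ is that of $\mathrm{dev}_\phi(E_1,\dots,E_n)$. *Automaton.* $G_{E^\sharp}$ has states $\mathrm{Pos}(E^\sharp)\uplus\{0\}$, initial state $0$, final states $\mathrm{Last}(E^\sharp)$ together with $0$ if $\mathrm{Null}(E^\sharp)$, a transition $0\xrightarrow{\,x\,}x$ for each $x\in\mathrm{First}(E^\sharp)$, and a transition $p\xrightarrow{\,x\,}x$ for each $(p,x)\in\mathrm{Follow}(E^\sharp)$. The position (Glushkov) automaton $G_E$ is $G_{E^\sharp}$ with every transition label $x$ replaced by $\mathrm h(x)$. **Theorem.** Let $E$ be an extended expression. The left-to-right numbering starting at $1$ is a linearization of $E$; and for every linearization $E^\sharp$ of $E$ and every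 choice of the numberings of satisfying interpretations, $G_E$ has finitely many states and recognizes $L(E)$: $$L(G_E)=L(E).$$ -/

import Mathlib

/-- Boolean formulae over a set `Γ` of atoms. An `n`-ary operator is given by its
associated Boolean function. -/
inductive BoolFormula (Γ : Type) : Type
  | atom (a : Γ) : BoolFormula Γ
  | op (n : ℕ) (f : (Fin n → Bool) → Bool) (args : Fin n → BoolFormula Γ) : BoolFormula Γ

/-- Evaluation of a Boolean formula with respect to an interpretation of its atoms. -/
def BoolFormula.eval {Γ : Type} (i : Γ → Bool) : BoolFormula Γ → Bool
  | .atom a => i a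
  | .op _ f args => f fun k => (args k).eval i

/-- `i(L₁, …, Lₙ)`: the catenation of the `Lₖ`, where `Lₖ` is replaced by `{ε}` when `i k`
is true. -/
def interpAction {α : Type*} {n : ℕ} (i : Fin n → Bool) (L : Fin n → Language α) : Language α :=
  (List.ofFn fun k => if i k = true then (1 : Language α) else L k).prod

/-- `φ(L₁, …, Lₙ)`: the union of the `i(L₁, …, Lₙ)` over the interpretations `i` satisfying
`φ`. -/
def formulaAction {α : Type*} {n : ℕ} (φ : BoolFormula (Fin n)) (L : Fin n → Language α) :
    Language α :=
  {w | ∃ i : Fin n → Bool, φ.eval i = true ∧ w ∈ interpAction i L}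

/-- Regular expressions extended with constrained multi-tildes. -/
inductive ExtExpr (α : Type*) : Type _
  | sym (a : α) : ExtExpr α
  | empty : ExtExpr α
  | eps : ExtExpr α
  | plus (E F : ExtExpr α) : ExtExpr α
  | cat (E F : ExtExpr α) : ExtExpr α
  | star (E : ExtExpr α) : ExtExpr α
  | tilde (n : ℕ) (φ : BoolFormula (Fin n)) (Es : Fin n → ExtExpr α) : ExtExpr α

namespace ExtExpr

/-- The language denoted by an extended expression. -/
def lang {α : Type*} : ExtExpr α → Language α
  | sym a => {[a]}
  | empty => 0
  | eps => 1
  | plus E F => E.lang + F.lang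
  | cat E F => E.lang * F.lang
  | star E => KStar.kstar E.lang
  | tilde _ φ Es => formulaAction φ fun k => (Es k).lang

/-- Substitution of every occurrence of a symbol `a` by `f a`. -/
def map {α β : Type*} (f : α → β) : ExtExpr α → ExtExpr β
  | sym a => sym (f a)
  | empty => empty
  | eps => eps
  | plus E F => plus (E.map f) (F.map f)
  | cat E F => cat (E.map f) (F.map f)
  | star E => star (E.map f)
  | tilde n φ Es => tilde n φ fun k => (Es k).map f

/-- The list of all occurrences of symbols, from left to right. -/
def symbols {α : Type*} : ExtExpr α → List α
  | sym a => [a]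
  | empty => []
  | eps => []
  | plus E F => E.symbols ++ F.symbols
  | cat E F => E.symbols ++ F.symbols
  | star E => E.symbols
  | tilde _ _ Es => (List.ofFn fun k => (Es k).symbols).flatten

/-- The nesting depth of constrained tildes. -/
def tildeDepth {α : Type*} : ExtExpr α → ℕ
  | sym _ => 0
  | empty => 0
  | eps => 0
  | plus E F => max E.tildeDepth F.tildeDepth
  | cat E F => max E.tildeDepth F.tildeDepth
  | star E => E.tildeDepth
  | tilde _ _ Es => (Finset.univ.sup fun k => (Es k).tildeDepth) + 1

/-- `E₁ + ⋯ + Eₖ`; the empty sum is `∅`. -/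
def sumList {α : Type*} : List (ExtExpr α) → ExtExpr α
  | [] => empty
  | [E] => E
  | E :: F :: l => plus E (sumList (F :: l))

/-- `E₁ · ⋯ · Eₖ`; the empty product is `ε`. -/
def prodList {α : Type*} : List (ExtExpr α) → ExtExpr α
  | [] => eps
  | [E] => E
  | E :: F :: l => cat E (prodList (F :: l))

end ExtExpr

/-- Indexed symbols `a_{k, [c₁, …, cₗ]}`. -/
abbrev IndexedSym (α : Type*) : Type _ := α × ℕ × List ℕ

/-- The delinearization function `h`, erasing the index. -/
def delin {α : Type*} (x : IndexedSym α) : α := x.1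

/-- `a_{k, [c₁, …, cₗ]} ↦ a_{k, [j, c₁, …, cₗ]}`. -/
def pushIndex {α : Type*} (j : ℕ) (x : IndexedSym α) : IndexedSym α := (x.1, x.2.1, j :: x.2.2)

/-- A family of numberings `i₁, …, iₖ` (without repetition) of the interpretations satisfying
each Boolean formula over `{1, …, n}`. -/
def IsEnumeration (enum : ∀ n : ℕ, BoolFormula (Fin n) → List (Fin n → Bool)) : Prop :=
  ∀ (n : ℕ) (φ : BoolFormula (Fin n)),
    (enum n φ).Nodup ∧ ∀ i : Fin n → Bool, i ∈ enum n φ ↔ φ.eval i = true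

namespace ExtExpr

/-- `E'` is a linearization of `E`: it is obtained from `E` by indexing every occurrence of a
symbol with a couple `(k, [])`, distinct occurrences getting distinct integers `k`. -/
def IsLinearization {α : Type*} (E : ExtExpr α) (E' : ExtExpr (IndexedSym α)) : Prop :=
  E'.map delin = E ∧ (∀ x ∈ E'.symbols, x.2.2 = []) ∧ (E'.symbols.map fun x => x.2.1).Nodup

/-- The linearization that numbers the occurrences of symbols from left to right, starting at
index `j`. -/
def linearize {α : Type*} : ℕ → ExtExpr α → ExtExpr (IndexedSym α)
  | j, sym a => sym (a, j, [])
  | _, empty => empty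
  | _, eps => eps
  | j, plus E F => plus (linearize j E) (linearize (j + E.symbols.length) F)
  | j, cat E F => cat (linearize j E) (linearize (j + E.symbols.length) F)
  | j, star E => star (linearize j E)
  | j, tilde n φ Es =>
      tilde n φ fun m => linearize (j + ∑ l ∈ Finset.Iio m, (Es l).symbols.length) (Es m)

/-- The summand of the development associated with the interpretation `i` numbered `j`: the
product of the operands that `i` does not replace by `ε`, with `j` added to their indices. -/
def devInterp {α : Type*} {n : ℕ} (j : ℕ) (i : Fin n → Bool)
    (Es : Fin n → ExtExpr (IndexedSym α)) : ExtExpr (IndexedSym α) :=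
  prodList (((List.finRange n).filter fun m => i m = false).map fun m => (Es m).map (pushIndex j))

/-- The development of `φ(E₁, …, Eₙ)`: the sum over the interpretations satisfying `φ`, numbered
from `1`. -/
def devFormula {α : Type*} (enum : ∀ n : ℕ, BoolFormula (Fin n) → List (Fin n → Bool)) {n : ℕ}
    (φ : BoolFormula (Fin n)) (Es : Fin n → ExtExpr (IndexedSym α)) : ExtExpr (IndexedSym α) :=
  sumList ((enum n φ).mapIdx fun j i => devInterp (j + 1) i Es)

theorem tildeDepth_map {α β : Type*} (f : α → β) (E : ExtExpr α) :
    (E.map f).tildeDepth = E.tildeDepth := by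
  induction E <;> simp_all [map, tildeDepth]

theorem tildeDepth_sumList_le {α : Type*} (d : ℕ) (l : List (ExtExpr α))
    (h : ∀ E ∈ l, E.tildeDepth ≤ d) : (sumList l).tildeDepth ≤ d := by
  induction l using sumList.induct <;> simp_all [sumList, tildeDepth]

theorem tildeDepth_prodList_le {α : Type*} (d : ℕ) (l : List (ExtExpr α))
    (h : ∀ E ∈ l, E.tildeDepth ≤ d) : (prodList l).tildeDepth ≤ d := by
  induction l using prodList.induct <;> simp_all [prodList, tildeDepth]

/-- The development has a smaller tilde depth, so that the recursions below terminate. -/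
theorem tildeDepth_devFormula_lt {α : Type*}
    (enum : ∀ n : ℕ, BoolFormula (Fin n) → List (Fin n → Bool)) {n : ℕ}
    (φ : BoolFormula (Fin n)) (Es : Fin n → ExtExpr (IndexedSym α)) :
    (devFormula enum φ Es).tildeDepth < (tilde n φ Es).tildeDepth := by
  refine Nat.lt_succ_of_le (tildeDepth_sumList_le _ _ fun E hE => ?_)
  obtain ⟨j, hj, rfl⟩ := List.mem_mapIdx.1 hE
  refine tildeDepth_prodList_le _ _ fun F hF => ?_
  obtain ⟨m, -, rfl⟩ := List.mem_map.1 hF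
  rw [tildeDepth_map]
  exact Finset.le_sup (f := fun k => (Es k).tildeDepth) (Finset.mem_univ m)

/-- `Null(E)`: the empty word belongs to the language denoted by `E`. -/
def Null {α : Type*} (E : ExtExpr α) : Prop := [] ∈ E.lang

/-- The set of positions. -/
def pos {α : Type*} (enum : ∀ n : ℕ, BoolFormula (Fin n) → List (Fin n → Bool)) :
    ExtExpr (IndexedSym α) → Set (IndexedSym α)
  | sym a => {a}
  | empty => ∅
  | eps => ∅
  | plus E F => pos enum E ∪ pos enum F
  | cat E F => pos enum E ∪ pos enum F
  | star E => pos enum E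
  | tilde _ φ Es => pos enum (devFormula enum φ Es)
termination_by E => (E.tildeDepth, sizeOf E)
decreasing_by
  all_goals first
    | exact Prod.Lex.left _ _ (tildeDepth_devFormula_lt enum _ _)
    | exact Prod.Lex.right' _ (by simp [tildeDepth]) (by simp; try omega)

/-- The set of first positions. -/
def first {α : Type*} (enum : ∀ n : ℕ, BoolFormula (Fin n) → List (Fin n → Bool)) :
    ExtExpr (IndexedSym α) → Set (IndexedSym α)
  | sym a => {a}
  | empty => ∅
  | eps => ∅
  | plus E F => first enum E ∪ first enum F
  | cat E F => first enum E ∪ {x | E.Null ∧ x ∈ first enum F}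
  | star E => first enum E
  | tilde _ φ Es => first enum (devFormula enum φ Es)
termination_by E => (E.tildeDepth, sizeOf E)
decreasing_by
  all_goals first
    | exact Prod.Lex.left _ _ (tildeDepth_devFormula_lt enum _ _)
    | exact Prod.Lex.right' _ (by simp [tildeDepth]) (by simp; try omega)

/-- The set of last positions. -/
def last {α : Type*} (enum : ∀ n : ℕ, BoolFormula (Fin n) → List (Fin n → Bool)) :
    ExtExpr (IndexedSym α) → Set (IndexedSym α)
  | sym a => {a}
  | empty => ∅
  | eps => ∅
  | plus E F => last enum E ∪ last enum F
  | cat E F => last enum F ∪ {x | F.Null ∧ x ∈ last enum E}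
  | star E => last enum E
  | tilde _ φ Es => last enum (devFormula enum φ Es)
termination_by E => (E.tildeDepth, sizeOf E)
decreasing_by
  all_goals first
    | exact Prod.Lex.left _ _ (tildeDepth_devFormula_lt enum _ _)
    | exact Prod.Lex.right' _ (by simp [tildeDepth]) (by simp; try omega)

/-- The set of couples of successive positions. -/
def follow {α : Type*} (enum : ∀ n : ℕ, BoolFormula (Fin n) → List (Fin n → Bool)) :
    ExtExpr (IndexedSym α) → Set (IndexedSym α × IndexedSym α)
  | sym _ => ∅
  | empty => ∅
  | eps => ∅
  | plus E F => follow enum E ∪ follow enum F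
  | cat E F => follow enum E ∪ follow enum F ∪ last enum E ×ˢ first enum F
  | star E => follow enum E ∪ last enum E ×ˢ first enum E
  | tilde _ φ Es => follow enum (devFormula enum φ Es)
termination_by E => (E.tildeDepth, sizeOf E)
decreasing_by
  all_goals first
    | exact Prod.Lex.left _ _ (tildeDepth_devFormula_lt enum _ _)
    | exact Prod.Lex.right' _ (by simp [tildeDepth]) (by simp; try omega)

/-- The Glushkov automaton of an indexed expression: its states are the positions and an
additional initial state `0`, written `none`. -/
def glushkov {α : Type*} (enum : ∀ n : ℕ, BoolFormula (Fin n) → List (Fin n → Bool))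
    (E : ExtExpr (IndexedSym α)) : NFA (IndexedSym α) (Option (pos enum E)) where
  start := {none}
  accept := {q | match q with
    | none => E.Null
    | some p => p.1 ∈ last enum E}
  step q a := {q' | ∃ b : pos enum E, q' = some b ∧ b.1 = a ∧
    match q with
    | none => b.1 ∈ first enum E
    | some p => (p.1, b.1) ∈ follow enum E}

end ExtExpr

/-- Relabelling of the transitions of an automaton. -/
def relabelNFA {α β σ : Type*} (h : α → β) (M : NFA α σ) : NFA β σ where
  start := M.start
  accept := M.accept
  step q b := {q' | ∃ a, h a = b ∧ q' ∈ M.step q a}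

/-- The position automaton `G_E` obtained from a linearization `E'` of `E`: the Glushkov
automaton of `E'` with its transitions relabelled by the delinearization function. -/
def positionAutomaton {α : Type*}
    (enum : ∀ n : ℕ, BoolFormula (Fin n) → List (Fin n → Bool)) (E' : ExtExpr (IndexedSym α)) :
    NFA α (Option (ExtExpr.pos enum E')) :=
  relabelNFA delin (E'.glushkov enum)

/-! Developing every tilde of $E^\sharp$ gives an ordinary regular expression $R$, `develop enum
E'`, with the same position functions and the same nullability (`samePositions_develop`). So
$G_{E^\sharp}$ is the Glushkov automaton of $R$, and three facts remain.

$R$ is linear (`linear_develop`): two operands of one product have different integers $k$, and two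
summands of one development have different interpretation numbers in their indices. A linear
expression denotes a local language (`Linear.isLocal`): a nonempty word belongs to it exactly when
it starts in First, moves along Follow and ends in Last. This is what the Glushkov automaton tests,
so it recognizes $L(R)$ (`glushkov_accepts`). Finally $R$ denotes $L(E)$ once the indices are erased
(`matches'_map_develop`), and relabelling an automaton maps its language (`relabelNFA_accepts`).

The recursion for the position functions develops the outermost tilde first and pushes indices in
front, so the number coming from the outermost tilde ends up last. Hence $R$ can be built by
structural recursion, each tilde appending its number at the end. The two orders are reconciled in
`samePositions_map_develop` by carrying an arbitrary suffix $c$ of indices. -/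

namespace RegularExpression

/-! ### Position functions of ordinary regular expressions -/

open scoped Computability

variable {α : Type*}

/-- The set of positions of a regular expression. -/
def positions : RegularExpression α → Set α
  | 0 => ∅
  | 1 => ∅
  | char a => {a}
  | P + Q => P.positions ∪ Q.positions
  | P * Q => P.positions ∪ Q.positions
  | star P => P.positions

/-- The set of first positions of a regular expression. -/
def firstPos : RegularExpression α → Set α
  | 0 => ∅
  | 1 => ∅
  | char a => {a}
  | P + Q => P.firstPos ∪ Q.firstPos
  | P * Q => P.firstPos ∪ {x | [] ∈ P.matches' ∧ x ∈ Q.firstPos}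
  | star P => P.firstPos

/-- The set of last positions of a regular expression. -/
def lastPos : RegularExpression α → Set α
  | 0 => ∅
  | 1 => ∅
  | char a => {a}
  | P + Q => P.lastPos ∪ Q.lastPos
  | P * Q => Q.lastPos ∪ {x | [] ∈ Q.matches' ∧ x ∈ P.lastPos}
  | star P => P.lastPos

/-- The set of couples of successive positions of a regular expression. -/
def followPos : RegularExpression α → Set (α × α)
  | 0 => ∅
  | 1 => ∅
  | char _ => ∅
  | P + Q => P.followPos ∪ Q.followPos
  | P * Q => P.followPos ∪ Q.followPos ∪ P.lastPos ×ˢ Q.firstPos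
  | star P => P.followPos ∪ P.lastPos ×ˢ P.firstPos

/-- No symbol occurs twice in the expression. -/
def Linear : RegularExpression α → Prop
  | 0 => True
  | 1 => True
  | char _ => True
  | P + Q => P.Linear ∧ Q.Linear ∧ Disjoint P.positions Q.positions
  | P * Q => P.Linear ∧ Q.Linear ∧ Disjoint P.positions Q.positions
  | star P => P.Linear

theorem finite_positions : ∀ P : RegularExpression α, P.positions.Finite
  | 0 => Set.finite_empty
  | 1 => Set.finite_empty
  | char a => Set.finite_singleton a
  | P + Q => P.finite_positions.union Q.finite_positions
  | P * Q => P.finite_positions.union Q.finite_positions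
  | star P => P.finite_positions

theorem firstPos_subset : ∀ P : RegularExpression α, P.firstPos ⊆ P.positions
  | 0 => subset_rfl
  | 1 => subset_rfl
  | char _ => subset_rfl
  | P + Q => Set.union_subset_union P.firstPos_subset Q.firstPos_subset
  | P * Q => Set.union_subset_union P.firstPos_subset fun _ h => Q.firstPos_subset h.2
  | star P => P.firstPos_subset

theorem lastPos_subset : ∀ P : RegularExpression α, P.lastPos ⊆ P.positions
  | 0 => subset_rfl
  | 1 => subset_rfl
  | char _ => subset_rfl
  | P + Q => Set.union_subset_union P.lastPos_subset Q.lastPos_subset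
  | P * Q => Set.union_subset (Q.lastPos_subset.trans Set.subset_union_right) fun _ h =>
      Or.inl (P.lastPos_subset h.2)
  | star P => P.lastPos_subset

theorem followPos_subset : ∀ P : RegularExpression α, P.followPos ⊆ P.positions ×ˢ P.positions
  | 0 => Set.empty_subset _
  | 1 => Set.empty_subset _
  | char _ => Set.empty_subset _
  | P + Q => by
      rintro x (h | h)
      · exact ⟨Or.inl (P.followPos_subset h).1, Or.inl (P.followPos_subset h).2⟩
      · exact ⟨Or.inr (Q.followPos_subset h).1, Or.inr (Q.followPos_subset h).2⟩
  | P * Q => by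
      rintro x ((h | h) | h)
      · exact ⟨Or.inl (P.followPos_subset h).1, Or.inl (P.followPos_subset h).2⟩
      · exact ⟨Or.inr (Q.followPos_subset h).1, Or.inr (Q.followPos_subset h).2⟩
      · exact ⟨Or.inl (P.lastPos_subset h.1), Or.inr (Q.firstPos_subset h.2)⟩
  | star P => by
      rintro x (h | h)
      · exact P.followPos_subset h
      · exact ⟨P.lastPos_subset h.1, P.firstPos_subset h.2⟩

end RegularExpression

/-! ### Linear expressions denote local languages -/

/-- Starting from `p`, the word `w` is a path along the couples in `F` that ends in `B`. -/
def IsRun {α : Type*} (F : Set (α × α)) (B : Set α) : α → List α → Prop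
  | p, [] => p ∈ B
  | p, x :: w => (p, x) ∈ F ∧ IsRun F B x w

namespace RegularExpression

open scoped Computability

variable {α : Type*}

/-- The words that can be read after position `p`. -/
def residual (P : RegularExpression α) (p : α) : Language α :=
  {w | IsRun P.followPos P.lastPos p w}

@[simp]
theorem nil_mem_residual {P : RegularExpression α} {p : α} :
    [] ∈ P.residual p ↔ p ∈ P.lastPos := Iff.rfl

@[simp]
theorem cons_mem_residual {P : RegularExpression α} {p x : α} {w : List α} :
    x :: w ∈ P.residual p ↔ (p, x) ∈ P.followPos ∧ w ∈ P.residual x := Iff.rfl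

/-- Follow never links the two sides of a sum, and disjointness tells from the position which side a
run is on. -/
theorem residual_add_left {P Q : RegularExpression α} (h : Disjoint P.positions Q.positions)
    {p : α} (hp : p ∈ P.positions) (w : List α) : w ∈ (P + Q).residual p ↔ w ∈ P.residual p := by
  have hd := Set.disjoint_left.1 h
  induction w generalizing p with
  | nil => exact ⟨fun h => h.resolve_right fun h => hd hp (Q.lastPos_subset h), Or.inl⟩
  | cons x w ih =>
    have : (p, x) ∈ (P + Q).followPos ↔ (p, x) ∈ P.followPos :=
      ⟨fun h => h.resolve_right fun h => hd hp (Q.followPos_subset h).1, Or.inl⟩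
    rw [cons_mem_residual, cons_mem_residual, this]
    exact and_congr_right fun h => ih (P.followPos_subset h).2

theorem residual_add_right {P Q : RegularExpression α} (h : Disjoint P.positions Q.positions)
    {p : α} (hp : p ∈ Q.positions) (w : List α) : w ∈ (P + Q).residual p ↔ w ∈ Q.residual p := by
  have hd := Set.disjoint_right.1 h
  induction w generalizing p with
  | nil => exact ⟨fun h => h.resolve_left fun h => hd hp (P.lastPos_subset h), Or.inr⟩
  | cons x w ih =>
    have : (p, x) ∈ (P + Q).followPos ↔ (p, x) ∈ Q.followPos :=
      ⟨fun h => h.resolve_left fun h => hd hp (P.followPos_subset h).1, Or.inr⟩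
    rw [cons_mem_residual, cons_mem_residual, this]
    exact and_congr_right fun h => ih (Q.followPos_subset h).2

/-- A run that has entered `Q` cannot return: every couple of the product that starts in `Q` is a
couple of `Q`. -/
theorem residual_mul_right {P Q : RegularExpression α} (h : Disjoint P.positions Q.positions)
    {p : α} (hp : p ∈ Q.positions) (w : List α) : w ∈ (P * Q).residual p ↔ w ∈ Q.residual p := by
  have hd := Set.disjoint_right.1 h
  induction w generalizing p with
  | nil => exact ⟨fun h => h.resolve_right fun h => hd hp (P.lastPos_subset h.2), Or.inl⟩
  | cons x w ih =>
    have : (p, x) ∈ (P * Q).followPos ↔ (p, x) ∈ Q.followPos := by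
      refine ⟨?_, fun h => Or.inl (Or.inr h)⟩
      rintro ((h | h) | h)
      · exact (hd hp (P.followPos_subset h).1).elim
      · exact h
      · exact (hd hp (P.lastPos_subset h.1)).elim
    rw [cons_mem_residual, cons_mem_residual, this]
    exact and_congr_right fun h => ih (Q.followPos_subset h).2

theorem cons_mem_mul {L M : Language α} {x : α} {w : List α} :
    x :: w ∈ L * M ↔ (∃ u v, u ++ v = w ∧ x :: u ∈ L ∧ v ∈ M) ∨ [] ∈ L ∧ x :: w ∈ M := by
  rw [Language.mem_mul]
  constructor
  · rintro ⟨_ | ⟨y, u⟩, hu, v, hv, h⟩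
    · exact Or.inr ⟨hu, by simpa using h ▸ hv⟩
    · obtain ⟨rfl, rfl⟩ := List.cons_eq_cons.1 h
      exact Or.inl ⟨u, v, rfl, hu, hv⟩
  · rintro (⟨u, v, rfl, hu, hv⟩ | ⟨h, hw⟩)
    · exact ⟨_, hu, v, hv, rfl⟩
    · exact ⟨_, h, _, hw, rfl⟩

theorem nil_mem_mul {L M : Language α} : [] ∈ L * M ↔ [] ∈ L ∧ [] ∈ M := by
  simp [Language.mem_mul]

theorem cons_mem_kstar {L : Language α} {x : α} {w : List α} :
    x :: w ∈ L∗ ↔ ∃ u v, u ++ v = w ∧ x :: u ∈ L ∧ v ∈ L∗ := by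
  constructor
  · intro hw
    -- With all factors nonempty, the letter `x` has to come from the first one.
    obtain ⟨S, hS, h⟩ := Language.mem_kstar_iff_exists_nonempty.1 hw
    rcases S with _ | ⟨_ | ⟨y, u⟩, S⟩
    · simp at hS
    · simp at h
    · simp only [List.flatten_cons, List.cons_append, List.cons.injEq] at hS
      obtain ⟨rfl, rfl⟩ := hS
      exact ⟨u, S.flatten, rfl, (h _ (by simp)).1,
        Language.join_mem_kstar fun y hy => (h y (by simp [hy])).1⟩
  · rintro ⟨u, v, rfl, hu, hv⟩
    rw [← Language.one_add_self_mul_kstar_eq_kstar]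
    exact Or.inr ⟨_, hu, v, hv, rfl⟩

/-- A nonempty word is denoted by `P` when it starts with a first position and continues with a
word of its residual. -/
def IsLocal (P : RegularExpression α) : Prop :=
  ∀ (x : α) (w : List α), x :: w ∈ P.matches' ↔ x ∈ P.firstPos ∧ w ∈ P.residual x

/-- The run crosses once from a last position of `P` to a first position of `Q`, or stops in `P`
when `Q` is nullable. Locality of `Q` turns the part after the crossing into a word of `Q`. -/
theorem residual_mul_left {P Q : RegularExpression α} (h : Disjoint P.positions Q.positions)
    (hQ : Q.IsLocal) {p : α} (hp : p ∈ P.positions) (w : List α) :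
    w ∈ (P * Q).residual p ↔ w ∈ P.residual p * Q.matches' := by
  have hd := Set.disjoint_left.1 h
  induction w generalizing p with
  | nil =>
    rw [nil_mem_mul, nil_mem_residual, nil_mem_residual]
    exact ⟨fun h => (h.resolve_left fun h => hd hp (Q.lastPos_subset h)).symm, fun h => Or.inr h.symm⟩
  | cons x w ih =>
    rw [cons_mem_residual, cons_mem_mul]
    constructor
    · rintro ⟨(h1 | h1) | h1, h2⟩
      · obtain ⟨u, hu, v, hv, rfl⟩ := (ih (P.followPos_subset h1).2).1 h2
        exact Or.inl ⟨u, v, rfl, ⟨h1, hu⟩, hv⟩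
      · exact (hd hp (Q.followPos_subset h1).1).elim
      · rw [residual_mul_right h (Q.firstPos_subset h1.2)] at h2
        exact Or.inr ⟨h1.1, (hQ _ _).2 ⟨h1.2, h2⟩⟩
    · rintro (⟨u, v, rfl, ⟨h1, hu⟩, hv⟩ | ⟨h1, h2⟩)
      · exact ⟨Or.inl (Or.inl h1), (ih (P.followPos_subset h1).2).2 ⟨u, hu, v, hv, rfl⟩⟩
      · rw [hQ] at h2
        exact ⟨Or.inr ⟨h1, h2.1⟩, (residual_mul_right h (Q.firstPos_subset h2.1) _).2 h2.2⟩

/-- Each use of a couple in Last × First closes one factor and opens the next. A couple may lie both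
there and in `P.followPos`; this is harmless, since only the existence of a factorization matters.
-/
theorem residual_star {P : RegularExpression α} (hP : P.IsLocal) {p : α} (w : List α) :
    w ∈ (star P).residual p ↔ w ∈ P.residual p * P.matches'∗ := by
  induction w generalizing p with
  | nil =>
    rw [nil_mem_mul]
    exact (and_iff_left (Language.nil_mem_kstar _)).symm
  | cons x w ih =>
    rw [cons_mem_residual, cons_mem_mul, cons_mem_kstar, ih]
    constructor
    · rintro ⟨h1 | h1, u, hu, v, hv, rfl⟩
      · exact Or.inl ⟨u, v, rfl, ⟨h1, hu⟩, hv⟩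
      · exact Or.inr ⟨h1.1, u, v, rfl, (hP _ _).2 ⟨h1.2, hu⟩, hv⟩
    · rintro (⟨u, v, rfl, ⟨h1, hu⟩, hv⟩ | ⟨h1, u, v, rfl, hu, hv⟩)
      · exact ⟨Or.inl h1, u, hu, v, hv, rfl⟩
      · rw [hP] at hu
        exact ⟨Or.inr ⟨h1, hu.1⟩, u, hu.2, v, hv, rfl⟩

theorem Linear.isLocal : ∀ {P : RegularExpression α}, P.Linear → P.IsLocal
  | 0, _, x, w => by simp [firstPos]
  | 1, _, x, w => by simp [firstPos, Language.mem_one]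
  | char a, _, x, w => by
      rw [matches'_char]
      change x :: w = [a] ↔ x = a ∧ IsRun ∅ {a} x w
      cases w with
      | nil => simp [IsRun]
      | cons y w => simp [IsRun]
  | P + Q, ⟨hP, hQ, hd⟩, x, w => by
      rw [matches'_add, Language.mem_add, hP.isLocal, hQ.isLocal]
      change _ ↔ (x ∈ P.firstPos ∨ x ∈ Q.firstPos) ∧ _
      rw [or_and_right]
      exact or_congr
        (and_congr_right fun h => (residual_add_left hd (P.firstPos_subset h) w).symm)
        (and_congr_right fun h => (residual_add_right hd (Q.firstPos_subset h) w).symm)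
  | P * Q, ⟨hP, hQ, hd⟩, x, w => by
      rw [matches'_mul, cons_mem_mul, hQ.isLocal]
      change _ ↔ (x ∈ P.firstPos ∨ [] ∈ P.matches' ∧ x ∈ Q.firstPos) ∧ _
      rw [or_and_right, and_assoc]
      refine or_congr ?_ (and_congr_right fun _ => and_congr_right fun h =>
        (residual_mul_right hd (Q.firstPos_subset h) w).symm)
      constructor
      · rintro ⟨u, v, rfl, hu, hv⟩
        rw [hP.isLocal] at hu
        exact ⟨hu.1, (residual_mul_left hd hQ.isLocal (P.firstPos_subset hu.1) _).2
          ⟨u, hu.2, v, hv, rfl⟩⟩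
      · rintro ⟨h, hw⟩
        obtain ⟨u, hu, v, hv, rfl⟩ :=
          (residual_mul_left hd hQ.isLocal (P.firstPos_subset h) _).1 hw
        exact ⟨u, v, rfl, (hP.isLocal _ _).2 ⟨h, hu⟩, hv⟩
  | star P, hP, x, w => by
      have hP : P.IsLocal := Linear.isLocal hP
      rw [matches'_star, cons_mem_kstar, residual_star hP]
      constructor
      · rintro ⟨u, v, rfl, hu, hv⟩
        rw [hP] at hu
        exact ⟨hu.1, u, hu.2, v, hv, rfl⟩
      · rintro ⟨h, u, hu, v, hv, rfl⟩
        exact ⟨u, v, rfl, (hP _ _).2 ⟨h, hu⟩, hv⟩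

end RegularExpression

/-! ### Relabelling an automaton -/

theorem relabelNFA_acceptsFrom {α β σ : Type*} (h : α → β) (M : NFA α σ) (S : Set σ)
    (w : List β) :
    w ∈ (relabelNFA h M).acceptsFrom S ↔ ∃ v ∈ M.acceptsFrom S, v.map h = w := by
  induction w generalizing S with
  | nil => simp [relabelNFA, NFA.nil_mem_acceptsFrom]
  | cons b w ih =>
    -- Reading `b` amounts to reading any of its preimages, and acceptance commutes with unions of
    -- state sets.
    have hS : (relabelNFA h M).stepSet S b = ⋃ a, ⋃ (_ : h a = b), M.stepSet S a := by
      ext q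
      simp only [NFA.mem_stepSet, Set.mem_iUnion]
      constructor
      · rintro ⟨t, ht, a, ha, hq⟩
        exact ⟨a, ha, t, ht, hq⟩
      · rintro ⟨a, ha, t, ht, hq⟩
        exact ⟨t, ht, a, ha, hq⟩
    rw [NFA.cons_mem_acceptsFrom, ih, hS, NFA.acceptsFrom_iUnion₂]
    constructor
    · rintro ⟨v, hv, rfl⟩
      obtain ⟨a, rfl, hva⟩ :=
        (Set.mem_iUnion₂ (s := fun a (_ : h a = b) => M.acceptsFrom (M.stepSet S a))).1 hv
      exact ⟨a :: v, (NFA.cons_mem_acceptsFrom _).2 hva, rfl⟩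
    · rintro ⟨_ | ⟨a, v⟩, hv, he⟩
      · simp at he
      · obtain ⟨rfl, rfl⟩ := List.cons_eq_cons.1 he
        exact ⟨v, (Set.mem_iUnion₂ (s := fun x (_ : h x = h a) =>
          M.acceptsFrom (M.stepSet S x))).2 ⟨a, rfl, (NFA.cons_mem_acceptsFrom _).1 hv⟩, rfl⟩

theorem relabelNFA_accepts {α β σ : Type*} (h : α → β) (M : NFA α σ) :
    (relabelNFA h M).accepts = Language.map h M.accepts := by
  ext w
  exact relabelNFA_acceptsFrom h M M.start w

/-! ### The Glushkov automaton recognizes the local language -/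

namespace ExtExpr

variable {α : Type*} (enum : ∀ n : ℕ, BoolFormula (Fin n) → List (Fin n → Bool))

/-- The position functions and nullability of `E` are those of the regular expression `R`. -/
structure SamePositions (E : ExtExpr (IndexedSym α)) (R : RegularExpression (IndexedSym α)) :
    Prop where
  pos_eq : pos enum E = R.positions
  first_eq : first enum E = R.firstPos
  last_eq : last enum E = R.lastPos
  follow_eq : follow enum E = R.followPos
  null_iff : E.Null ↔ [] ∈ R.matches'

theorem glushkov_acceptsFrom_some {E : ExtExpr (IndexedSym α)} (p : pos enum E)
    (hF : follow enum E ⊆ pos enum E ×ˢ pos enum E) (w : List (IndexedSym α)) :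
    w ∈ (E.glushkov enum).acceptsFrom {some p} ↔
      IsRun (follow enum E) (last enum E) p.1 w := by
  induction w generalizing p with
  | nil => simp [NFA.nil_mem_acceptsFrom, glushkov, IsRun]
  | cons x w ih =>
    rw [NFA.cons_mem_acceptsFrom, NFA.stepSet_singleton]
    by_cases hx : (p.1, x) ∈ follow enum E
    · have : (E.glushkov enum).step (some p) x = {some ⟨x, (hF hx).2⟩} := by
        ext q
        constructor
        · rintro ⟨b, rfl, rfl, -⟩
          rfl
        · rintro rfl
          exact ⟨_, rfl, rfl, hx⟩
      rw [this, ih]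
      exact (and_iff_right hx).symm
    · have : (E.glushkov enum).step (some p) x = ∅ := by
        ext q
        simp only [Set.mem_empty_iff_false, iff_false]
        rintro ⟨b, rfl, rfl, h⟩
        exact hx h
      rw [this]
      simp [NFA.mem_acceptsFrom, NFA.mem_evalFrom_iff_exists (S := ∅), IsRun, hx]

theorem glushkov_accepts {E : ExtExpr (IndexedSym α)} {R : RegularExpression (IndexedSym α)}
    (h : SamePositions enum E R) (hR : R.Linear) : (E.glushkov enum).accepts = R.matches' := by
  have hF : follow enum E ⊆ pos enum E ×ˢ pos enum E := by
    rw [h.follow_eq, h.pos_eq]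
    exact R.followPos_subset
  ext w
  rw [NFA.accepts_eq_acceptsFrom_start]
  change w ∈ (E.glushkov enum).acceptsFrom {none} ↔ _
  cases w with
  | nil => simpa [NFA.nil_mem_acceptsFrom, glushkov] using h.null_iff
  | cons x w =>
    rw [NFA.cons_mem_acceptsFrom, NFA.stepSet_singleton, hR.isLocal]
    by_cases hx : x ∈ first enum E
    · have hp : x ∈ pos enum E := by
        rw [h.pos_eq]
        exact R.firstPos_subset (h.first_eq ▸ hx)
      have : (E.glushkov enum).step none x = {some ⟨x, hp⟩} := by
        ext q
        constructor
        · rintro ⟨b, rfl, rfl, -⟩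
          rfl
        · rintro rfl
          exact ⟨_, rfl, rfl, hx⟩
      rw [this, glushkov_acceptsFrom_some enum _ hF, h.follow_eq, h.last_eq, ← h.first_eq]
      exact (and_iff_right hx).symm
    · have : (E.glushkov enum).step none x = ∅ := by
        ext q
        simp only [Set.mem_empty_iff_false, iff_false]
        rintro ⟨b, rfl, rfl, h⟩
        exact hx h
      rw [this]
      rw [h.first_eq] at hx
      simp [NFA.mem_acceptsFrom, NFA.mem_evalFrom_iff_exists (S := ∅), hx]

end ExtExpr

/-! ### Finite sums and products of regular expressions -/

namespace RegularExpression

variable {α β : Type*}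

theorem map_sum (f : α → β) (l : List (RegularExpression α)) :
    l.sum.map f = (l.map (map f)).sum := by
  induction l with
  | nil => rfl
  | cons P l ih =>
    rw [List.map_cons, List.sum_cons, List.sum_cons, ← ih]
    rfl

theorem map_prod (f : α → β) (l : List (RegularExpression α)) :
    l.prod.map f = (l.map (map f)).prod := by
  induction l with
  | nil => rfl
  | cons P l ih =>
    rw [List.map_cons, List.prod_cons, List.prod_cons, ← ih]
    rfl

theorem mem_matches'_sum {l : List (RegularExpression α)} {w : List α} :
    w ∈ l.sum.matches' ↔ ∃ P ∈ l, w ∈ P.matches' := by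
  induction l with
  | nil => simp
  | cons P l ih => simp [Language.mem_add, ih]

theorem matches'_prod (l : List (RegularExpression α)) :
    l.prod.matches' = (l.map matches').prod := by
  induction l with
  | nil => rfl
  | cons P l ih => simp [ih]

theorem positions_map (f : α → β) :
    ∀ P : RegularExpression α, (P.map f).positions = f '' P.positions
  | 0 => (Set.image_empty f).symm
  | 1 => (Set.image_empty f).symm
  | char _ => Set.image_singleton.symm
  | P + Q => by simp only [map, positions, positions_map f P, positions_map f Q, Set.image_union]
  | P * Q => by simp only [map, positions, positions_map f P, positions_map f Q, Set.image_union]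
  | star P => by simp only [map, positions, positions_map f P]

theorem Linear.map {f : α → β} (hf : Function.Injective f) {P : RegularExpression α}
    (h : P.Linear) : (P.map f).Linear := by
  induction P with
  | zero => trivial
  | epsilon => trivial
  | char _ => trivial
  | plus P Q ihP ihQ =>
    refine ⟨ihP h.1, ihQ h.2.1, ?_⟩
    rw [positions_map, positions_map]
    exact (Set.disjoint_image_iff hf).2 h.2.2
  | comp P Q ihP ihQ =>
    refine ⟨ihP h.1, ihQ h.2.1, ?_⟩
    rw [positions_map, positions_map]
    exact (Set.disjoint_image_iff hf).2 h.2.2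
  | star P ih => exact ih h

theorem mem_positions_sum {l : List (RegularExpression α)} {x : α} :
    x ∈ l.sum.positions ↔ ∃ P ∈ l, x ∈ P.positions := by
  induction l with
  | nil => simp [positions]
  | cons P l ih => simp [positions, ih]

theorem mem_positions_prod {l : List (RegularExpression α)} {x : α} :
    x ∈ l.prod.positions ↔ ∃ P ∈ l, x ∈ P.positions := by
  induction l with
  | nil => simp [positions]
  | cons P l ih => simp [positions, ih]

theorem linear_sum {l : List (RegularExpression α)} (h : ∀ P ∈ l, P.Linear)
    (hd : l.Pairwise fun P Q => Disjoint P.positions Q.positions) : l.sum.Linear := by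
  induction l with
  | nil => trivial
  | cons P l ih =>
    rw [List.pairwise_cons] at hd
    rw [List.sum_cons]
    refine ⟨h _ (by simp), ih (fun Q hQ => h Q (by simp [hQ])) hd.2, ?_⟩
    refine Set.disjoint_left.2 fun x hx hl => ?_
    obtain ⟨Q, hQ, hxQ⟩ := mem_positions_sum.1 hl
    exact Set.disjoint_left.1 (hd.1 Q hQ) hx hxQ

theorem linear_prod {l : List (RegularExpression α)} (h : ∀ P ∈ l, P.Linear)
    (hd : l.Pairwise fun P Q => Disjoint P.positions Q.positions) : l.prod.Linear := by
  induction l with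
  | nil => trivial
  | cons P l ih =>
    rw [List.pairwise_cons] at hd
    rw [List.prod_cons]
    refine ⟨h _ (by simp), ih (fun Q hQ => h Q (by simp [hQ])) hd.2, ?_⟩
    refine Set.disjoint_left.2 fun x hx hl => ?_
    obtain ⟨Q, hQ, hxQ⟩ := mem_positions_prod.1 hl
    exact Set.disjoint_left.1 (hd.1 Q hQ) hx hxQ

end RegularExpression

/-! ### The full development and its language -/

/-- `a_{k, [b₁, …, bₗ]} ↦ a_{k, [b₁, …, bₗ, c₁, …, cₘ]}`. -/
def appendIndex {α : Type*} (c : List ℕ) (x : IndexedSym α) : IndexedSym α :=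
  (x.1, x.2.1, x.2.2 ++ c)

theorem appendIndex_injective {α : Type*} (c : List ℕ) :
    Function.Injective (appendIndex (α := α) c) := by
  rintro ⟨a, k, l⟩ ⟨b, k', l'⟩ h
  simpa [appendIndex] using h

theorem appendIndex_comp {α : Type*} (c d : List ℕ) :
    appendIndex (α := α) c ∘ appendIndex d = appendIndex (d ++ c) := by
  ext x <;> simp [appendIndex]

namespace ExtExpr

variable {α β γ : Type*}

theorem map_map (g : β → γ) (f : α → β) (E : ExtExpr α) : (E.map f).map g = E.map (g ∘ f) := by
  induction E <;> simp_all [map]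

theorem mem_symbols_tilde {n : ℕ} {φ : BoolFormula (Fin n)} {Es : Fin n → ExtExpr α} {x : α} :
    x ∈ (tilde n φ Es).symbols ↔ ∃ k, x ∈ (Es k).symbols := by
  simp [symbols]

theorem map_congr {f g : α → β} {E : ExtExpr α} (h : ∀ x ∈ E.symbols, f x = g x) :
    E.map f = E.map g := by
  induction E with
  | tilde n φ Es ih =>
    simp only [map, tilde.injEq, heq_eq_eq, true_and]
    exact funext fun k => ih k fun x hx => h x (mem_symbols_tilde.2 ⟨k, hx⟩)
  | _ => simp_all [map, symbols]

theorem map_id (E : ExtExpr α) : E.map id = E := by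
  induction E <;> simp_all [map]

theorem lang_map (f : α → β) (E : ExtExpr α) : (E.map f).lang = Language.map f E.lang := by
  induction E with
  | sym a => exact (Set.image_singleton (f := List.map f) (a := [a])).symm
  | empty => exact (map_zero _).symm
  | eps => exact (map_one _).symm
  | plus E F ihE ihF => simp [map, lang, ihE, ihF]
  | cat E F ihE ihF => simp [map, lang, ihE, ihF]
  | star E ih => simp [map, lang, ih]
  | tilde n φ Es ih =>
    have hi (i : Fin n → Bool) : interpAction i (fun k => ((Es k).map f).lang) =
        Language.map f (interpAction i fun k => (Es k).lang) := by
      simp only [interpAction, map_list_prod, List.map_ofFn, ih]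
      congr 2
      ext1 k
      by_cases h : i k = true <;> simp [h]
    ext w
    simp only [map, lang, formulaAction]
    constructor
    · rintro ⟨i, hφ, hw⟩
      rw [hi] at hw
      obtain ⟨v, hv, rfl⟩ := hw
      exact ⟨v, ⟨i, hφ, hv⟩, rfl⟩
    · rintro ⟨v, ⟨i, hφ, hv⟩, rfl⟩
      exact ⟨i, hφ, by rw [hi]; exact ⟨v, hv, rfl⟩⟩

theorem nil_mem_language_map (f : α → β) (L : Language α) : [] ∈ Language.map f L ↔ [] ∈ L := by
  constructor
  · rintro ⟨v, hv, h⟩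
    rwa [List.map_eq_nil_iff.1 h] at hv
  · exact fun h => ⟨[], h, rfl⟩

theorem null_map (f : α → β) (E : ExtExpr α) : (E.map f).Null ↔ E.Null := by
  rw [Null, lang_map, nil_mem_language_map, Null]

variable (enum : ∀ n : ℕ, BoolFormula (Fin n) → List (Fin n → Bool))

/-- The regular expression obtained by developing all the tildes of an expression whose symbols
have empty lists of indices. -/
def develop : ExtExpr (IndexedSym α) → RegularExpression (IndexedSym α)
  | sym a => .char a
  | empty => 0
  | eps => 1
  | plus E F => E.develop + F.develop
  | cat E F => E.develop * F.develop
  | star E => .star E.develop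
  | tilde n φ Es => ((enum n φ).mapIdx fun j i => (((List.finRange n).filter fun m =>
      i m = false).map fun m => (develop (Es m)).map (appendIndex [j + 1])).prod).sum

theorem develop_tilde_map {n : ℕ} (φ : BoolFormula (Fin n)) (Es : Fin n → ExtExpr (IndexedSym α))
    (f : IndexedSym α → β) :
    (develop enum (tilde n φ Es)).map f = ((enum n φ).mapIdx fun j i => (((List.finRange n).filter
      fun m => i m = false).map fun m =>
        (develop enum (Es m)).map (f ∘ appendIndex [j + 1])).prod).sum := by
  rw [develop, RegularExpression.map_sum]
  refine congrArg _ (List.ext_getElem (by simp) fun j _ _ => ?_)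
  simp only [List.getElem_map, List.getElem_mapIdx, Function.comp_def,
    RegularExpression.map_prod, List.map_map, RegularExpression.map_map]

/-- Omitting an operand from the product has the same effect as replacing its language by
$\{\varepsilon\}$, the unit of catenation. -/
theorem prod_filter_finRange {n : ℕ} (i : Fin n → Bool) (L : Fin n → Language α) :
    (((List.finRange n).filter fun m => i m = false).map L).prod = interpAction i L := by
  rw [interpAction, List.ofFn_eq_map]
  induction List.finRange n with
  | nil => rfl
  | cons m l ih => by_cases h : i m = true <;> simp_all

/-- The languages are compared after `delin` because developing changes the indices of the symbols.
-/
theorem matches'_map_develop (henum : IsEnumeration enum) (E : ExtExpr (IndexedSym α)) :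
    ((develop enum E).map delin).matches' = (E.map delin).lang := by
  induction E with
  | sym a => rfl
  | empty => rfl
  | eps => rfl
  | plus E F ihE ihF => simp [develop, map, lang, RegularExpression.map, ihE, ihF]
  | cat E F ihE ihF => simp [develop, map, lang, RegularExpression.map, ihE, ihF]
  | star E ih => simp [develop, map, lang, RegularExpression.map, ih]
  | tilde n φ Es ih =>
    have hdelin (c : List ℕ) : delin (α := α) ∘ appendIndex c = delin := rfl
    ext w
    rw [develop_tilde_map, RegularExpression.mem_matches'_sum]
    simp only [hdelin, map, lang]
    have hi (i : Fin n → Bool) : (((List.finRange n).filter fun m => i m = false).map fun m =>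
        (develop enum (Es m)).map delin).prod.matches' =
          interpAction i fun k => ((Es k).map delin).lang := by
      rw [RegularExpression.matches'_prod, List.map_map, ← prod_filter_finRange]
      simp only [Function.comp_def, ih]
    constructor
    · rintro ⟨P, hP, hw⟩
      obtain ⟨j, hj, rfl⟩ := List.mem_mapIdx.1 hP
      rw [hi] at hw
      exact ⟨_, ((henum n φ).2 _).1 (List.getElem_mem hj), hw⟩
    · rintro ⟨i, hφ, hw⟩
      obtain ⟨j, hj, rfl⟩ := List.getElem_of_mem (((henum n φ).2 i).2 hφ)
      exact ⟨_, List.mem_mapIdx.2 ⟨j, hj, rfl⟩, by rwa [hi]⟩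

/-- Erasing indices preserves the length of words, so nullability can be compared after `delin`. -/
theorem null_iff_develop (henum : IsEnumeration enum) (E : ExtExpr (IndexedSym α)) :
    E.Null ↔ [] ∈ (develop enum E).matches' := by
  rw [← null_map delin, Null, ← matches'_map_develop enum henum, RegularExpression.matches'_map,
    nil_mem_language_map]

end ExtExpr

/-! ### Linearity of the development -/

namespace ExtExpr

variable {α : Type*} (enum : ∀ n : ℕ, BoolFormula (Fin n) → List (Fin n → Bool))

/-- Development only alters lists of indices, so the integer of a position still identifies an
occurrence of $E^\sharp$. -/
theorem mem_symbols_of_mem_positions_develop {E : ExtExpr (IndexedSym α)} {x : IndexedSym α}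
    (hx : x ∈ (develop enum E).positions) : ∃ y ∈ E.symbols, y.2.1 = x.2.1 := by
  induction E generalizing x with
  | sym a =>
    obtain rfl : x = a := hx
    exact ⟨x, List.mem_singleton_self _, rfl⟩
  | empty => exact hx.elim
  | eps => exact hx.elim
  | plus E F ihE ihF =>
    rcases hx with hx | hx
    · obtain ⟨y, hy, h⟩ := ihE hx
      exact ⟨y, List.mem_append_left _ hy, h⟩
    · obtain ⟨y, hy, h⟩ := ihF hx
      exact ⟨y, List.mem_append_right _ hy, h⟩
  | cat E F ihE ihF =>
    rcases hx with hx | hx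
    · obtain ⟨y, hy, h⟩ := ihE hx
      exact ⟨y, List.mem_append_left _ hy, h⟩
    · obtain ⟨y, hy, h⟩ := ihF hx
      exact ⟨y, List.mem_append_right _ hy, h⟩
  | star E ih => exact ih hx
  | tilde n φ Es ih =>
    rw [develop, RegularExpression.mem_positions_sum] at hx
    obtain ⟨P, hP, hx⟩ := hx
    obtain ⟨j, hj, rfl⟩ := List.mem_mapIdx.1 hP
    obtain ⟨Q, hQ, hx⟩ := RegularExpression.mem_positions_prod.1 hx
    obtain ⟨m, -, rfl⟩ := List.mem_map.1 hQ
    rw [RegularExpression.positions_map] at hx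
    obtain ⟨z, hz, rfl⟩ := hx
    obtain ⟨y, hy, h⟩ := ih m hz
    exact ⟨y, mem_symbols_tilde.2 ⟨m, hy⟩, h⟩

/-- The maps `f` and `g` cover both uses: the identity for `plus` and `cat`, and the appending of an
index for the operands of a tilde. -/
theorem disjoint_positions_develop {E F : ExtExpr (IndexedSym α)}
    (h : ∀ x ∈ E.symbols, ∀ y ∈ F.symbols, x.2.1 ≠ y.2.1) (f g : IndexedSym α → IndexedSym α)
    (hf : ∀ x, (f x).2.1 = x.2.1) (hg : ∀ x, (g x).2.1 = x.2.1) :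
    Disjoint ((develop enum E).map f).positions ((develop enum F).map g).positions := by
  rw [RegularExpression.positions_map, RegularExpression.positions_map, Set.disjoint_left]
  rintro _ ⟨x, hx, rfl⟩ ⟨y, hy, hxy⟩
  obtain ⟨x', hx', ex⟩ := mem_symbols_of_mem_positions_develop enum hx
  obtain ⟨y', hy', ey⟩ := mem_symbols_of_mem_positions_develop enum hy
  exact h x' hx' y' hy' (by rw [ex, ey, ← hf, ← hg y, hxy])

theorem linear_develop {E : ExtExpr (IndexedSym α)} (h : (E.symbols.map fun x => x.2.1).Nodup) :
    (develop enum E).Linear := by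
  induction E with
  | sym a => trivial
  | empty => trivial
  | eps => trivial
  | plus E F ihE ihF =>
    rw [symbols, List.map_append, List.nodup_append] at h
    refine ⟨ihE h.1, ihF h.2.1, ?_⟩
    have := disjoint_positions_develop enum (E := E) (F := F) (fun x hx y hy =>
      h.2.2 _ (List.mem_map_of_mem hx) _ (List.mem_map_of_mem hy)) id id (fun _ => rfl) fun _ => rfl
    simpa using this
  | cat E F ihE ihF =>
    rw [symbols, List.map_append, List.nodup_append] at h
    refine ⟨ihE h.1, ihF h.2.1, ?_⟩
    have := disjoint_positions_develop enum (E := E) (F := F) (fun x hx y hy =>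
      h.2.2 _ (List.mem_map_of_mem hx) _ (List.mem_map_of_mem hy)) id id (fun _ => rfl) fun _ => rfl
    simpa using this
  | star E ih => exact ih h
  | tilde n φ Es ih =>
    rw [symbols, List.map_flatten, List.map_ofFn, List.nodup_flatten, List.pairwise_ofFn] at h
    obtain ⟨hn, hd⟩ := h
    have hne {k l : Fin n} (hkl : k ≠ l) :
        ∀ x ∈ (Es k).symbols, ∀ y ∈ (Es l).symbols, x.2.1 ≠ y.2.1 := by
      intro x hx y hy hxy
      rcases lt_or_gt_of_ne hkl with hlt | hlt
      · exact hd hlt (List.mem_map_of_mem hx) (hxy ▸ List.mem_map_of_mem hy)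
      · exact hd hlt (List.mem_map_of_mem hy) (hxy ▸ List.mem_map_of_mem hx)
    refine RegularExpression.linear_sum ?_ ?_
    · intro P hP
      obtain ⟨j, hj, rfl⟩ := List.mem_mapIdx.1 hP
      refine RegularExpression.linear_prod ?_ ?_
      · intro Q hQ
        obtain ⟨m, -, rfl⟩ := List.mem_map.1 hQ
        exact (ih m (hn _ ((List.mem_ofFn' _ _).2 ⟨m, rfl⟩))).map (appendIndex_injective _)
      · refine List.Pairwise.map _ (fun k l hkl => ?_) ((List.nodup_finRange n).filter _)
        exact disjoint_positions_develop enum (hne hkl) _ _ (fun _ => rfl) fun _ => rfl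
    · rw [List.pairwise_iff_getElem]
      intro j j' hj hj' hlt
      -- Two summands may contain the same operand, so the integers do not separate them; the last
      -- index, the number of the summand, does.
      have hlast {k : ℕ} {i : Fin n → Bool} {x : IndexedSym α}
          (hx : x ∈ (((List.finRange n).filter fun m => i m = false).map fun m =>
            (develop enum (Es m)).map (appendIndex [k + 1])).prod.positions) :
          x.2.2.getLast? = some (k + 1) := by
        obtain ⟨Q, hQ, hx⟩ := RegularExpression.mem_positions_prod.1 hx
        obtain ⟨m, -, rfl⟩ := List.mem_map.1 hQ
        rw [RegularExpression.positions_map] at hx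
        obtain ⟨z, hz, rfl⟩ := hx
        simp [appendIndex]
      rw [Set.disjoint_left]
      intro x hx hx'
      rw [List.getElem_mapIdx] at hx hx'
      have := (hlast hx).symm.trans (hlast hx')
      simp only [Option.some.injEq] at this
      omega

/-! ### Agreement of the position functions -/

section SamePositions

variable {enum} {E F : ExtExpr (IndexedSym α)} {P Q : RegularExpression (IndexedSym α)}

theorem SamePositions.empty : SamePositions enum (.empty : ExtExpr (IndexedSym α)) 0 where
  pos_eq := by rw [pos]; rfl
  first_eq := by rw [first]; rfl
  last_eq := by rw [last]; rfl
  follow_eq := by rw [follow]; rfl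
  null_iff := Iff.rfl

theorem SamePositions.eps : SamePositions enum (.eps : ExtExpr (IndexedSym α)) 1 where
  pos_eq := by rw [pos]; rfl
  first_eq := by rw [first]; rfl
  last_eq := by rw [last]; rfl
  follow_eq := by rw [follow]; rfl
  null_iff := Iff.rfl

theorem SamePositions.sym (a : IndexedSym α) : SamePositions enum (.sym a) (.char a) where
  pos_eq := by rw [pos]; rfl
  first_eq := by rw [first]; rfl
  last_eq := by rw [last]; rfl
  follow_eq := by rw [follow]; rfl
  null_iff := Iff.rfl

theorem SamePositions.plus (hE : SamePositions enum E P) (hF : SamePositions enum F Q) :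
    SamePositions enum (.plus E F) (P + Q) where
  pos_eq := by rw [pos, hE.pos_eq, hF.pos_eq]; rfl
  first_eq := by rw [first, hE.first_eq, hF.first_eq]; rfl
  last_eq := by rw [last, hE.last_eq, hF.last_eq]; rfl
  follow_eq := by rw [follow, hE.follow_eq, hF.follow_eq]; rfl
  null_iff := or_congr hE.null_iff hF.null_iff

theorem SamePositions.cat (hE : SamePositions enum E P) (hF : SamePositions enum F Q) :
    SamePositions enum (.cat E F) (P * Q) where
  pos_eq := by rw [pos, hE.pos_eq, hF.pos_eq]; rfl
  first_eq := by
    rw [first, hE.first_eq, hF.first_eq]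
    simp only [hE.null_iff]
    rfl
  last_eq := by
    rw [last, hE.last_eq, hF.last_eq]
    simp only [hF.null_iff]
    rfl
  follow_eq := by
    rw [follow, hE.follow_eq, hF.follow_eq, hE.last_eq, hF.first_eq]
    rfl
  null_iff := by
    rw [RegularExpression.matches'_mul, RegularExpression.nil_mem_mul, Null, lang,
      RegularExpression.nil_mem_mul]
    exact and_congr hE.null_iff hF.null_iff

theorem SamePositions.star (hE : SamePositions enum E P) :
    SamePositions enum (.star E) (.star P) where
  pos_eq := by rw [pos, hE.pos_eq]; rfl
  first_eq := by rw [first, hE.first_eq]; rfl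
  last_eq := by rw [last, hE.last_eq]; rfl
  follow_eq := by
    rw [follow, hE.follow_eq, hE.last_eq, hE.first_eq]
    rfl
  null_iff := iff_of_true (Language.nil_mem_kstar _) (Language.nil_mem_kstar _)

/-- `List.sum` ends with a summand `0` that `sumList` omits; likewise for `1` and products below. -/
theorem SamePositions.add_zero (hE : SamePositions enum E P) : SamePositions enum E (P + 0) where
  pos_eq := by simp [RegularExpression.positions, hE.pos_eq]
  first_eq := by simp [RegularExpression.firstPos, hE.first_eq]
  last_eq := by simp [RegularExpression.lastPos, hE.last_eq]
  follow_eq := by simp [RegularExpression.followPos, hE.follow_eq]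
  null_iff := by simp [hE.null_iff]

theorem SamePositions.mul_one (hE : SamePositions enum E P) : SamePositions enum E (P * 1) where
  pos_eq := by simp [RegularExpression.positions, hE.pos_eq]
  first_eq := by simp [RegularExpression.firstPos, hE.first_eq]
  last_eq := by simp [RegularExpression.lastPos, hE.last_eq]
  follow_eq := by simp [RegularExpression.firstPos, RegularExpression.followPos, hE.follow_eq]
  null_iff := by simp [hE.null_iff]

theorem SamePositions.sumList : ∀ {Es : List (ExtExpr (IndexedSym α))}
    {Ps : List (RegularExpression (IndexedSym α))},
    List.Forall₂ (SamePositions enum) Es Ps → SamePositions enum (sumList Es) Ps.sum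
  | _, _, .nil => .empty
  | _, _, .cons h .nil => h.add_zero
  | _, _, .cons h (.cons h' hl) => h.plus (SamePositions.sumList (.cons h' hl))

theorem SamePositions.prodList : ∀ {Es : List (ExtExpr (IndexedSym α))}
    {Ps : List (RegularExpression (IndexedSym α))},
    List.Forall₂ (SamePositions enum) Es Ps → SamePositions enum (prodList Es) Ps.prod
  | _, _, .nil => .eps
  | _, _, .cons h .nil => h.mul_one
  | _, _, .cons h (.cons h' hl) => h.cat (SamePositions.prodList (.cons h' hl))

end SamePositions

/-- The suffix `c` holds the numbers already pushed by the enclosing tildes; it must be arbitrary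
because the operands of a tilde numbered `j` are met with suffix `j :: c`. -/
theorem samePositions_map_develop (henum : IsEnumeration enum) {E : ExtExpr (IndexedSym α)}
    (hE : ∀ x ∈ E.symbols, x.2.2 = []) (c : List ℕ) :
    SamePositions enum (E.map (appendIndex c)) ((develop enum E).map (appendIndex c)) := by
  induction E generalizing c with
  | sym a => exact .sym _
  | empty => exact .empty
  | eps => exact .eps
  | plus E F ihE ihF =>
    exact (ihE (fun x hx => hE x (List.mem_append_left _ hx)) c).plus
      (ihF (fun x hx => hE x (List.mem_append_right _ hx)) c)
  | cat E F ihE ihF =>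
    exact (ihE (fun x hx => hE x (List.mem_append_left _ hx)) c).cat
      (ihF (fun x hx => hE x (List.mem_append_right _ hx)) c)
  | star E ih => exact (ih hE c).star
  | tilde n φ Es ih =>
    have hEs (m : Fin n) : ∀ x ∈ (Es m).symbols, x.2.2 = [] := fun x hx =>
      hE x (mem_symbols_tilde.2 ⟨m, hx⟩)
    -- On an empty list of indices, appending `c` and then pushing `j` in front is the same as
    -- appending `j :: c`.
    have hpush (j : ℕ) (m : Fin n) : ((Es m).map (appendIndex c)).map (pushIndex j) =
        (Es m).map (appendIndex (j :: c)) := by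
      rw [map_map]
      exact map_congr fun x hx => by simp [pushIndex, appendIndex, hEs m x hx]
    have key : SamePositions enum (devFormula enum φ fun m => (Es m).map (appendIndex c))
        ((develop enum (tilde n φ Es)).map (appendIndex c)) := by
      rw [develop_tilde_map]
      simp only [appendIndex_comp]
      refine SamePositions.sumList (List.forall₂_iff_get.2 ⟨by simp, fun j _ _ => ?_⟩)
      simp only [List.get_eq_getElem, List.getElem_mapIdx]
      refine SamePositions.prodList ?_
      rw [List.forall₂_map_left_iff, List.forall₂_map_right_iff, List.forall₂_same]
      intro m _
      rw [hpush]
      exact ih m (hEs m) _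
    rw [map]
    exact
      { pos_eq := by rw [pos, key.pos_eq]
        first_eq := by rw [first, key.first_eq]
        last_eq := by rw [last, key.last_eq]
        follow_eq := by rw [follow, key.follow_eq]
        null_iff := by
          -- Null is defined through the language and not through the development, so it is compared
          -- separately.
          rw [← map, null_map, null_iff_develop enum henum, RegularExpression.matches'_map,
            nil_mem_language_map] }

theorem samePositions_develop (henum : IsEnumeration enum) {E : ExtExpr (IndexedSym α)}
    (hE : ∀ x ∈ E.symbols, x.2.2 = []) : SamePositions enum E (develop enum E) := by
  have happ : appendIndex (α := α) [] = id := by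
    ext x <;> simp [appendIndex]
  have := samePositions_map_develop enum henum hE []
  rwa [happ, map_id, RegularExpression.map_id] at this

/-! ### The left-to-right numbering -/

theorem map_delin_linearize (j : ℕ) (E : ExtExpr α) : (E.linearize j).map delin = E := by
  induction E generalizing j <;> simp_all [map, linearize, delin]

theorem index_nil_of_mem_symbols_linearize (j : ℕ) (E : ExtExpr α) :
    ∀ x ∈ (E.linearize j).symbols, x.2.2 = [] := by
  induction E generalizing j with
  | tilde n φ Es ih =>
    intro x hx
    obtain ⟨k, hx⟩ := mem_symbols_tilde.1 hx
    exact ih k _ x hx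
  | plus E F ihE ihF =>
    intro x hx
    exact (List.mem_append.1 hx).elim (ihE _ x) (ihF _ x)
  | cat E F ihE ihF =>
    intro x hx
    exact (List.mem_append.1 hx).elim (ihE _ x) (ihF _ x)
  | star E ih => exact ih j
  | _ => simp [linearize, symbols]

/-- Consecutive blocks of integers, each starting where the previous one ends, concatenate to one
interval; the induction peels off the last block. -/
theorem flatten_ofFn_range' {n : ℕ} (j : ℕ) (f : Fin n → ℕ) :
    (List.ofFn fun m => List.range' (j + ∑ l ∈ Finset.Iio m, f l) (f m)).flatten =
      List.range' j (∑ l, f l) := by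
  induction n with
  | zero => simp
  | succ n ih =>
    rw [List.ofFn_succ', List.concat_eq_append, List.flatten_append, Fin.sum_univ_castSucc]
    simp only [Fin.sum_Iio_castSucc]
    rw [ih fun m => f m.castSucc, ← List.range'_append_1]
    simp

/-- Knowing the exact list of integers, and not merely that they are distinct, is what makes the
induction go through. -/
theorem map_symbols_linearize (j : ℕ) (E : ExtExpr α) :
    (E.linearize j).symbols.map (fun x => x.2.1) = List.range' j E.symbols.length := by
  induction E generalizing j with
  | tilde n φ Es ih =>
    rw [linearize, symbols, List.map_flatten, List.map_ofFn]
    simp only [Function.comp_def, ih, symbols]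
    rw [flatten_ofFn_range' j fun m => (Es m).symbols.length]
    simp [List.length_flatten, List.map_ofFn, List.sum_ofFn]
  | _ => simp_all [linearize, symbols]

theorem isLinearization_linearize (j : ℕ) (E : ExtExpr α) : E.IsLinearization (E.linearize j) :=
  ⟨map_delin_linearize j E, index_nil_of_mem_symbols_linearize j E, by
    rw [map_symbols_linearize]
    exact List.nodup_range'⟩

end ExtExpr

theorem mainTheorem2 {α : Type*}
    (enum : ∀ n : ℕ, BoolFormula (Fin n) → List (Fin n → Bool)) (henum : IsEnumeration enum)
    (E : ExtExpr α) :
    E.IsLinearization (E.linearize 1) ∧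
    ∀ E' : ExtExpr (IndexedSym α), E.IsLinearization E' →
      Finite (Option (ExtExpr.pos enum E')) ∧
      (positionAutomaton enum E').accepts = E.lang := by
  refine ⟨E.isLinearization_linearize 1, fun E' ⟨hmap, hnil, hnodup⟩ => ?_⟩
  have h := ExtExpr.samePositions_develop enum henum hnil
  constructor
  · have : Finite (ExtExpr.pos enum E') := by
      rw [h.pos_eq]
      exact (RegularExpression.finite_positions _).to_subtype
    infer_instance
  · rw [positionAutomaton, relabelNFA_accepts,
      ExtExpr.glushkov_accepts enum h (ExtExpr.linear_develop enum hnodup),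
      ← RegularExpression.matches'_map, ExtExpr.matches'_map_develop enum henum, hmap]
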